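/- For a finite set $S$, equip $S^{\mathbb Z}$ with the distance $d(c,c)=0$ and $d(c,c')=2^{-\min\{|j|\,:\,c_j\neq c'_j\}}$ for $c\neq c'$. A map $F:S^{\mathbb Z}\to S^{\mathbb Z}$ is positively expansive if there is $\varepsilon>0$ such that for all $c\neq c'$ in $S^{\mathbb Z}$ there is $\ell\in\mathbb N$ with $d(F^\ell(c),F^\ell(c'))\geq\varepsilon$. The cellular automaton (CA) over $S$ of radius $r\in\mathbb N$ with local rule $f:S^{2r+1}\to S$ is the map $F:S^{\mathbb Z}\to S^{\mathbb Z}$, $F(c)_i=f(c_{i-r},\dots,c_{i+r})$. If $G$ is a finite abelian group, a CA $F$ over $G$ is additive if $F$ is an endomorphism of the group $G^{\mathbb Z}$. **(1)** Positive expansivity is decidable for additive CA over finite abelian groups: there is one algorithm which, given as input any finite abelian group $G$ (as an addition table), any $r\in\mathbb N$ and any local rule $f:G^{2r+1}\to G$ (as a table of values) whose CA $F$ is additive, decides whether $F$ is positively expansive. **(2)** Let $p$ be a prime, $n\geq1$, and $k_1\geq k_2\geq\dots\geq k_n\geq1$ integers. Let $G=\mathbb Z/p^{k_1}\mathbb Z\times\dots\times\mathbb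 Z/p^{k_n}\mathbb Z$ and $\hat G=(\mathbb Z/p^{k_1}\mathbb Z)^n$, and let $\Psi:G^{\mathbb Z}\to\hat G^{\mathbb Z}$ be given by $(\Psi(c)_j)^i=p^{k_1-k_i}\,(c_j)^i$, where $h^i$ denotes the $i$-th component of $h$. Let $F$ be an additive CA over $G$ of radius $r$ with local rule $f$. For $-r\leq z\leq r$ and $g\in G$ let $f_z(g)$ be the value of $f$ at the word having $g$ at position $z$ and $0$ elsewhere. Let $L$ be the associated linear CA over $\hat G$, $L(b)_i=\sum_{z=-r}^{r}A_z\,b_{i+z}$, where $A_z\in(\mathbb Z/p^{k_1}\mathbb Z)^{n\times n}$ has entries $(A_z)_{i,j}=p^{k_j-k_i}f_z(e_j)^i$; here $e_j$ is the $j$-th standard generator of $G$, $f_z(e_j)^i$ is represented by an integer in $[0,p^{k_i})$, and the product is an integer that is reduced modulo $p^{k_1}$ (for $k_j<k_i$, the representative is divisible by $p^{k_i-k_j}$). Then $\Psi$ is injective, $L\circ\Psi=\Psi\circ F$, and $F$ is positively expansive if and only if $L$ is positively expansive. -/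

import Mathlib

namespace AdditiveCA

/-- The Tychonoff distance on bi-infinite configurations: `0` if `c = c'`, and otherwise
`2 ^ (-m)`, where `m` is the least `|j|` over the positions `j` at which `c` and `c'` differ. -/
noncomputable def tychonoffDist {S : Type*} (c c' : ℤ → S) : ℝ :=
  open Classical in
  if c = c' then 0 else (1 / 2 : ℝ) ^ sInf {m : ℕ | ∃ j : ℤ, j.natAbs = m ∧ c j ≠ c' j}

/-- The global rule of the one-dimensional cellular automaton of radius `r` with local rule `f`:
`F(c)_i = f(c_{i-r}, …, c_{i+r})`. The index `t : Fin (2 * r + 1)` stands for the offset `t - r`. -/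
def globalRule {S : Type*} (r : ℕ) (f : (Fin (2 * r + 1) → S) → S) (c : ℤ → S) : ℤ → S :=
  fun i => f fun t => c (i + ((t : ℕ) : ℤ) - (r : ℤ))

/-- Positive expansivity of a self-map of the configuration space. -/
def PositivelyExpansive {S : Type*} (F : (ℤ → S) → (ℤ → S)) : Prop :=
  ∃ ε : ℝ, 0 < ε ∧ ∀ c c' : ℤ → S, c ≠ c' → ∃ l : ℕ, ε ≤ tychonoffDist (F^[l] c) (F^[l] c')

/-- The cellular automaton with local rule `f` is additive: its global rule is an endomorphism
of the group of configurations. -/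
def IsAdditive {G : Type*} [AddCommGroup G] (r : ℕ) (f : (Fin (2 * r + 1) → G) → G) : Prop :=
  ∀ c c' : ℤ → G, globalRule r f (c + c') = globalRule r f c + globalRule r f c'

/-- Finite inputs of the decision problem: the number of elements of the group, its addition
table (row by row), the radius, and the table of the local rule. -/
abbrev Code : Type := ℕ × List (List ℕ) × ℕ × List ℕ

/-- The input presenting the group `G`, with its elements numbered by `e : G ≃ Fin q`, and the
local rule `f` of radius `r`. The table of `f` runs over all words of length `2 * r + 1`, the
`w`-th word consisting of the `2 * r + 1` digits of `w` in base `q`, least significant first. -/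
def encodeCA {G : Type*} [AddCommGroup G] {q : ℕ} (e : G ≃ Fin q) (r : ℕ)
    (f : (Fin (2 * r + 1) → G) → G) : Code :=
  (q,
    List.ofFn fun a : Fin q => List.ofFn fun b : Fin q => ((e (e.symm a + e.symm b) : Fin q) : ℕ),
    r,
    List.ofFn fun w : Fin (q ^ (2 * r + 1)) =>
      ((e (f fun t => e.symm (finFunctionFinEquiv.symm w t)) : Fin q) : ℕ))

/-- The linear local rule given by the matrices `A t`: `(x_t)_t ↦ ∑ t, A t * x t`. -/
def linearLocalRule {K : Type*} [CommRing K] {n : ℕ} (r : ℕ)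
    (A : Fin (2 * r + 1) → Matrix (Fin n) (Fin n) K) :
    (Fin (2 * r + 1) → Fin n → K) → Fin n → K :=
  fun x => ∑ t, (A t).mulVec (x t)

/-- The group `ℤ/p^{k_1} × ⋯ × ℤ/p^{k_n}`. -/
abbrev PGroup (p : ℕ) {n : ℕ} (k : Fin n → ℕ) : Type := (i : Fin n) → ZMod (p ^ k i)

/-- The map `ψ` from `ℤ/p^{k_1} × ⋯ × ℤ/p^{k_n}` to `(ℤ/p^{k_1})^n`,
`ψ(h)^i = p^{k_1 - k_i} h^i`. The first index is `0`, so `k_1` is `k 0`. -/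
def psi (p : ℕ) {n : ℕ} [NeZero n] (k : Fin n → ℕ) (h : PGroup p k) :
    Fin n → ZMod (p ^ k 0) :=
  fun i => (((h i).val * p ^ (k 0 - k i) : ℕ) : ZMod (p ^ k 0))

/-- The componentwise extension `Ψ` of `ψ` to configurations. -/
def bigPsi (p : ℕ) {n : ℕ} [NeZero n] (k : Fin n → ℕ) (c : ℤ → PGroup p k) :
    ℤ → Fin n → ZMod (p ^ k 0) :=
  fun j => psi p k (c j)

/-- The matrices `A_z = (p^{k_j - k_i} f_z(e_j)^i)_{i,j}` of the linear CA associated with an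
additive CA, where `f_z(g)` is the value of the local rule `f` at the word with `g` at offset `z`
and `0` elsewhere, and `f_z(e_j)^i` is represented by an integer in `[0, p^{k_i})`. With truncated
subtraction, at most one of the two powers of `p` below is not `1`: if `k_j < k_i` the entry is
the quotient of `f_z(e_j)^i` by `p^{k_i - k_j}`, which is exact when `f_z` is additive. -/
def assocMatrix (p : ℕ) {n : ℕ} [NeZero n] (k : Fin n → ℕ) (r : ℕ)
    (f : (Fin (2 * r + 1) → PGroup p k) → PGroup p k) (z : Fin (2 * r + 1)) :
    Matrix (Fin n) (Fin n) (ZMod (p ^ k 0)) :=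
  Matrix.of fun i j =>
    ((p ^ (k j - k i) * (f (Pi.single z (Pi.single j 1)) i).val / p ^ (k i - k j) : ℕ) :
      ZMod (p ^ k 0))

/-- The global rule of the linear CA over `(ℤ/p^{k_1})^n` associated with the additive CA with
local rule `f`. -/
def assocLCA (p : ℕ) {n : ℕ} [NeZero n] (k : Fin n → ℕ) (r : ℕ)
    (f : (Fin (2 * r + 1) → PGroup p k) → PGroup p k) :
    (ℤ → Fin n → ZMod (p ^ k 0)) → (ℤ → Fin n → ZMod (p ^ k 0)) :=
  globalRule r (linearLocalRule r (assocMatrix p k r f))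

end AdditiveCA

/-!
Let `q` be the order of the group. Positive expansivity reduces to the `p`-torsion for the primes
`p ∣ q`, since every nonzero configuration has a nonzero multiple killed by a prime. Configurations
over the `p`-torsion that vanish far to the left are vectors of Laurent series over `ℤ/p`, on which
the automaton acts by a matrix `B`, and with `Λ` the lattice of power series, positive expansivity
gives, by compactness, an `N` such that `y, B y, …, B ^ N y ∈ Λ` implies `y ∈ X • Λ`. Conversely, as
a strip of zeros as wide as the radius decouples its two sides, this property and its mirror image
let one propagate zeros from such a strip to the whole line.

The heart of the matter is that such an `N` can be taken to be the dimension `n`. The map `B` is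
invertible, and `B⁻¹` preserves the lattice `{y | y, …, B ^ N y ∈ Λ}`, where it is topologically
nilpotent. Its characteristic polynomial is therefore congruent to `X ^ n` modulo the maximal ideal,
and Cayley-Hamilton writes `y` as a combination of `B y, …, B ^ n y` with coefficients in that
ideal. As `n ≤ q`, the failure of positive expansivity is witnessed by a space-time diagram with
`q` steps, of a size computable from the input, and the finitely many candidates can be searched.

Every configuration over `(ℤ/p^{k_1})^n` killed by `p` is in the image of `Ψ`, and every nonzero
configuration has a nonzero multiple of this kind, so zeros in space-time transfer from `F` to `L`.
-/

namespace AdditiveCA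

section Lattice

open Module Submodule
open scoped Pointwise

lemma coeff_charpoly_mem {R M : Type*} [CommRing R] [AddCommGroup M]
    [Module R M] [Module.Finite R M] [Module.Free R M] {I : Ideal R} [I.IsPrime] {φ : End R M}
    {m : ℕ} (hφ : ∀ y, (φ ^ m) y ∈ I • (⊤ : Submodule R M)) {i : ℕ}
    (hi : i ≠ finrank R M) : φ.charpoly.coeff i ∈ I := by
  have hnil : IsNilpotent (φ.baseChange (R ⧸ I)) := by
    refine ⟨m, TensorProduct.AlgebraTensorModule.curry_injective <| LinearMap.ext_ring <|
      LinearMap.ext fun y => ?_⟩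
    rw [← LinearMap.baseChange_pow]
    change (1 : R ⧸ I) ⊗ₜ[R] (φ ^ m) y = 0
    refine Submodule.smul_induction_on (hφ y) (fun a ha z _ => ?_) fun z w hz hw => ?_
    · rw [← TensorProduct.smul_tmul, Algebra.smul_def, Ideal.Quotient.algebraMap_eq,
        Ideal.Quotient.eq_zero_iff_mem.2 ha, zero_mul, TensorProduct.zero_tmul]
    · rw [TensorProduct.tmul_add, hz, hw, add_zero]
  have hchar := congrArg (fun P => P.coeff i) hnil.charpoly_eq_X_pow_finrank
  have := (algebraMap R (R ⧸ I)).domain_nontrivial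
  rw [← Ideal.Quotient.eq_zero_iff_mem]
  simpa [Polynomial.coeff_X_pow, hi] using hchar

variable {R K V : Type*} [CommRing R] [Field K] [Algebra R K]
  [AddCommGroup V] [Module K V] [Module R V] [IsScalarTower R K V]

/-- A linear map `B` is expansive at time `N` with respect to a submodule `Λ` and a uniformizer
`ϖ` if every vector whose first `N` iterates stay in `Λ` lies in `ϖ • Λ`. -/
def ExpansiveAt (Λ : Submodule R V) (ϖ : R) (B : V →ₗ[K] V) (N : ℕ) : Prop :=
  ∀ y, (∀ i ≤ N, (B ^ i) y ∈ Λ) → y ∈ ϖ • Λ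

/-- The vectors of which the iterates up to time `N` stay in `Λ`. -/
def stayIn (Λ : Submodule R V) (B : V →ₗ[K] V) (N : ℕ) : Submodule R V :=
  ⨅ i ∈ Finset.Iic N, Λ.comap ((B ^ i).restrictScalars R)

variable {Λ : Submodule R V} {ϖ : R} {B : V →ₗ[K] V} {N : ℕ}

lemma mem_stayIn {y : V} : y ∈ stayIn Λ B N ↔ ∀ i ≤ N, (B ^ i) y ∈ Λ := by
  simp [stayIn]

lemma stayIn_le : stayIn Λ B N ≤ Λ := fun _ hy => mem_stayIn.1 hy 0 (Nat.zero_le N)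

variable [IsDomain R] [IsDiscreteValuationRing R] [IsFractionRing R K]

lemma exists_pow_smul_mem [IsLattice K Λ] (hϖ : Irreducible ϖ) (y : V) :
    ∃ t : ℕ, ϖ ^ t • y ∈ Λ := by
  obtain ⟨x, hx, a, rfl⟩ := (IsLocalization.mem_span_iff (nonZeroDivisors R)).1
    (IsLattice.span_eq_top (A := K) (M := Λ) ▸ mem_top (x := y))
  rw [span_eq] at hx
  obtain ⟨t, u, hu⟩ := IsDiscreteValuationRing.associated_pow_irreducible
    (nonZeroDivisors.coe_ne_zero a) hϖ
  refine ⟨t, ?_⟩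
  rw [← hu, mul_comm, mul_smul, ← algebraMap_smul K (a : R), smul_smul,
    IsLocalization.mk'_spec'_mk (S := K)]
  simpa using Λ.smul_mem (u : R) hx

namespace ExpansiveAt

lemma mem_smul_of_pos [IsLattice K Λ] (h : ExpansiveAt Λ ϖ B N) (hϖ : Irreducible ϖ) {y : V}
    (hy : ∀ i, 1 ≤ i → i ≤ N → (B ^ i) y ∈ Λ) : y ∈ ϖ • Λ := by
  have := IsTorsionFree.trans_faithfulSMul R K V
  have mem_of_pow_smul_mem (t : ℕ) (ht : ϖ ^ t • y ∈ Λ) : y ∈ Λ := by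
    induction t with
    | zero => simpa using ht
    | succ t ih =>
      obtain ⟨z, hz, hzt⟩ := h (ϖ ^ (t + 1) • y) fun i hi => by
        obtain rfl | hi' := Nat.eq_zero_or_pos i
        · exact ht
        · rw [LinearMap.map_smul_of_tower]
          exact Λ.smul_mem _ (hy i hi' hi)
      refine ih (?_ : ϖ ^ t • y ∈ Λ)
      rw [pow_succ', mul_smul] at hzt
      exact smul_right_injective V hϖ.ne_zero hzt ▸ hz
  obtain ⟨t, ht⟩ := exists_pow_smul_mem (K := K) (Λ := Λ) hϖ y
  refine h y fun i hi => ?_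
  obtain rfl | hi' := Nat.eq_zero_or_pos i
  · exact mem_of_pow_smul_mem t ht
  · exact hy i hi' hi

lemma injective [IsLattice K Λ] (h : ExpansiveAt Λ ϖ B N) (hϖ : Irreducible ϖ) :
    Function.Injective B := by
  have hker : (LinearMap.ker B).restrictScalars R ≤ Λ := fun y hy => by
    refine smul_le_self_of_tower ϖ Λ (h.mem_smul_of_pos hϖ fun i hi _ => ?_)
    obtain ⟨i, rfl⟩ := Nat.exists_eq_add_of_le' hi
    rw [pow_succ, Module.End.mul_apply, show B y = 0 from hy, map_zero]
    exact Λ.zero_mem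
  have hdiv : (LinearMap.ker B).restrictScalars R ≤
      IsLocalRing.maximalIdeal R • (LinearMap.ker B).restrictScalars R := fun y hy => by
    have hϖK : algebraMap R K ϖ ≠ 0 := by simpa using hϖ.ne_zero
    rw [← inv_smul_smul₀ hϖK y, smul_comm, algebraMap_smul]
    exact smul_mem_smul ((IsLocalRing.mem_maximalIdeal ϖ).2 hϖ.not_isUnit)
      ((LinearMap.ker B).smul_mem _ hy)
  have hbot := eq_bot_of_le_smul_of_le_jacobson_bot _ _ (FG.of_le IsLattice.fg hker) hdiv
    (IsLocalRing.maximalIdeal_le_jacobson ⊥)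
  exact LinearMap.ker_eq_bot.1 ((restrictScalars_eq_bot_iff ..).1 hbot)

lemma inverse_mem [IsLattice K Λ] (h : ExpansiveAt Λ ϖ B N) (hϖ : Irreducible ϖ)
    {A : V →ₗ[K] V} (hBA : B * A = 1) {y : V} (hy : y ∈ stayIn Λ B N) :
    A y ∈ stayIn Λ B N ⊓ ϖ • Λ := by
  have hpos (i : ℕ) (hi : 1 ≤ i) (hiN : i ≤ N) : (B ^ i) (A y) ∈ Λ := by
    obtain ⟨i, rfl⟩ := Nat.exists_eq_add_of_le' hi
    rw [pow_succ, ← Module.End.mul_apply, mul_assoc, hBA, mul_one]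
    exact mem_stayIn.1 hy i (by omega)
  have hmem : A y ∈ ϖ • Λ := h.mem_smul_of_pos hϖ hpos
  refine ⟨mem_stayIn.2 fun i hi => ?_, hmem⟩
  obtain rfl | hi' := Nat.eq_zero_or_pos i
  · exact smul_le_self_of_tower ϖ Λ hmem
  · exact hpos i hi' hi

lemma inverse_pow_mem [IsLattice K Λ] (h : ExpansiveAt Λ ϖ B N) (hϖ : Irreducible ϖ)
    {A : V →ₗ[K] V} (hBA : B * A = 1) {y : V} (hy : y ∈ stayIn Λ B N) :
    (A ^ (N + 1)) y ∈ ϖ • stayIn Λ B N := by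
  have := IsTorsionFree.trans_faithfulSMul R K V
  have hA (i : ℕ) : (A ^ i) y ∈ stayIn Λ B N := by
    induction i with
    | zero => exact hy
    | succ i ih => exact pow_succ' A i ▸ (h.inverse_mem hϖ hBA ih).1
  have hAϖ (i : ℕ) : (A ^ (i + 1)) y ∈ ϖ • Λ := pow_succ' A i ▸ (h.inverse_mem hϖ hBA (hA i)).2
  obtain ⟨z, -, hz⟩ := hAϖ N
  refine ⟨z, mem_stayIn.2 fun i hi => ?_, hz⟩
  obtain ⟨w, hw, hwz⟩ := hAϖ (N - i)
  have hzw : ϖ • (B ^ i) z = ϖ • w := calc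
    ϖ • (B ^ i) z = (B ^ i) ((A ^ (N + 1)) y) := by
      rw [← LinearMap.map_smul_of_tower]; exact congrArg (B ^ i) hz
    _ = (A ^ (N - i + 1)) y := by
      rw [show N + 1 = i + (N - i + 1) by omega, pow_add A, ← Module.End.mul_apply, ← mul_assoc,
        pow_mul_pow_eq_one i hBA, one_mul]
    _ = ϖ • w := hwz.symm
  exact smul_right_injective V hϖ.ne_zero hzw ▸ hw

end ExpansiveAt

lemma exists_pow_smul_mem_stayIn [IsLattice K Λ] (hϖ : Irreducible ϖ) (y : V) :
    ∃ t : ℕ, ϖ ^ t • y ∈ stayIn Λ B N := by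
  choose t ht using fun i => exists_pow_smul_mem (K := K) (Λ := Λ) hϖ ((B ^ i) y)
  refine ⟨∑ i ∈ Finset.range (N + 1), t i, mem_stayIn.2 fun i hi => ?_⟩
  obtain ⟨s, hs⟩ := Nat.exists_eq_add_of_le' (Finset.single_le_sum (f := t)
    (fun _ _ => Nat.zero_le _) (Finset.mem_range.2 (Nat.lt_succ_of_le hi)))
  rw [LinearMap.map_smul_of_tower, hs, pow_add, mul_smul]
  exact Λ.smul_mem _ (ht i)

lemma isLattice_stayIn [IsLattice K Λ] (hϖ : Irreducible ϖ) : IsLattice K (stayIn Λ B N) where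
  fg := FG.of_le IsLattice.fg stayIn_le
  span_eq_top := by
    refine eq_top_iff'.2 fun y => ?_
    obtain ⟨t, ht⟩ := exists_pow_smul_mem_stayIn (Λ := Λ) (B := B) (N := N) hϖ y
    have hϖK : algebraMap R K (ϖ ^ t) ≠ 0 := by simpa using pow_ne_zero t hϖ.ne_zero
    rw [← inv_smul_smul₀ hϖK y, algebraMap_smul]
    exact (span K _).smul_mem _ (subset_span ht)

lemma exists_pow_eq_sum_of_isLattice [IsLattice K Λ] (hϖ : Irreducible ϖ)
    {A : V →ₗ[K] V} {m : ℕ} (hA : ∀ y ∈ Λ, A y ∈ Λ) (hAm : ∀ y ∈ Λ, (A ^ m) y ∈ ϖ • Λ) :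
    ∃ c : ℕ → R, (∀ i < finrank K V, c i ∈ IsLocalRing.maximalIdeal R) ∧
      ∀ y, (A ^ finrank K V) y = ∑ i ∈ Finset.range (finrank K V), c i • (A ^ i) y := by
  have := IsTorsionFree.trans_faithfulSMul R K V
  have := IsLattice.free (K := K) Λ
  have hrank : finrank R Λ = finrank K V := congrArg Cardinal.toNat (IsLattice.rank' K Λ)
  set φ : End R Λ := (A.restrictScalars R).restrict hA
  have coe_pow (i : ℕ) (u : Λ) : ((φ ^ i) u : V) = (A ^ i) u := by
    induction i with
    | zero => rfl
    | succ i ih => rw [pow_succ', pow_succ', Module.End.mul_apply, Module.End.mul_apply, ← ih]; rfl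
  have hφ (u : Λ) : (φ ^ m) u ∈ IsLocalRing.maximalIdeal R • (⊤ : Submodule R Λ) := by
    obtain ⟨z, hz, hzu⟩ := hAm u u.2
    rw [show (φ ^ m) u = ϖ • ⟨z, hz⟩ from Subtype.ext ((coe_pow m u).trans hzu.symm)]
    exact smul_mem_smul ((IsLocalRing.mem_maximalIdeal ϖ).2 hϖ.not_isUnit) mem_top
  refine ⟨fun i => -φ.charpoly.coeff i, fun i hi => neg_mem (coeff_charpoly_mem hφ
    (hrank ▸ hi.ne)), fun y => ?_⟩
  obtain ⟨t, ht⟩ := exists_pow_smul_mem (K := K) (Λ := Λ) hϖ y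
  have hCH : (A ^ finrank K V) (ϖ ^ t • y) +
      ∑ i ∈ Finset.range (finrank K V), φ.charpoly.coeff i • (A ^ i) (ϖ ^ t • y) = 0 := by
    have h := congrArg Subtype.val (LinearMap.congr_fun φ.aeval_self_charpoly ⟨_, ht⟩)
    rw [Polynomial.aeval_eq_sum_range, Finset.sum_range_succ, LinearMap.charpoly_natDegree,
      show φ.charpoly.coeff (finrank R Λ) = 1 from
        LinearMap.charpoly_natDegree φ ▸ φ.charpoly_monic.coeff_natDegree, one_smul, add_comm,
      hrank] at h
    simpa [coe_pow, LinearMap.sum_apply] using h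
  refine smul_right_injective V (pow_ne_zero t hϖ.ne_zero) ?_
  simpa only [LinearMap.map_smul_of_tower, Finset.smul_sum, neg_smul, Finset.sum_neg_distrib,
    smul_comm _ (ϖ ^ t), smul_neg] using eq_neg_of_add_eq_zero_left hCH

namespace ExpansiveAt

theorem expansiveAt_finrank [IsLattice K Λ] [FiniteDimensional K V] (h : ExpansiveAt Λ ϖ B N)
    (hϖ : Irreducible ϖ) : ExpansiveAt Λ ϖ B (finrank K V) := by
  obtain ⟨A, hBA⟩ : ∃ A : V →ₗ[K] V, B * A = 1 :=
    LinearMap.exists_rightInverse_of_surjective B (LinearMap.range_eq_top.2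
      (LinearMap.injective_iff_surjective.1 (h.injective hϖ)))
  have hAB : A * B = 1 := mul_eq_one_comm.1 hBA
  have := isLattice_stayIn (Λ := Λ) (B := B) (N := N) (K := K) hϖ
  obtain ⟨c, hc, hsum⟩ := exists_pow_eq_sum_of_isLattice hϖ
    (fun y hy => (h.inverse_mem hϖ hBA hy).1) fun y hy => h.inverse_pow_mem hϖ hBA hy
  intro y hy
  have pow_apply (i : ℕ) (hi : i ≤ finrank K V) :
      (A ^ i) ((B ^ finrank K V) y) = (B ^ (finrank K V - i)) y := by
    obtain ⟨k, hk⟩ := Nat.exists_eq_add_of_le hi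
    rw [hk, pow_add, ← Module.End.mul_apply, ← mul_assoc, pow_mul_pow_eq_one i hAB, one_mul,
      Nat.add_sub_cancel_left]
  have hy' : y = ∑ i ∈ Finset.range (finrank K V), c i • (B ^ (finrank K V - i)) y := by
    have := hsum ((B ^ finrank K V) y)
    rw [pow_apply _ le_rfl, Nat.sub_self] at this
    refine this.trans (Finset.sum_congr rfl fun i hi => ?_)
    rw [pow_apply i (Finset.mem_range.1 hi).le]
  rw [hy']
  refine sum_mem fun i hi => ?_
  obtain ⟨b, hb⟩ := Ideal.mem_span_singleton'.1 (hϖ.maximalIdeal_eq ▸ hc i (Finset.mem_range.1 hi))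
  rw [← hb, mul_comm, mul_smul]
  exact smul_mem_pointwise_smul _ _ _ (Λ.smul_mem _ (hy _ (Nat.sub_le ..)))

end ExpansiveAt

end Lattice

section PowerSeriesLattice

open PowerSeries LaurentSeries
open scoped Pointwise

variable {F : Type*} [Field F] {n : ℕ}

lemma mem_range_algebraMap_iff {y : LaurentSeries F} :
    y ∈ Set.range (algebraMap (PowerSeries F) (LaurentSeries F)) ↔ ∀ j < 0, y.coeff j = 0 := by
  rw [← LaurentSeries.valuation_le_iff_coeff_lt_eq_zero F (D := 0)]
  simpa using (LaurentSeries.val_le_one_iff_eq_coe F y).symm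

/-- The lattice of vectors of power series in the space of vectors of Laurent series. -/
noncomputable def powerSeriesLattice (F : Type*) [Field F] (n : ℕ) :
    Submodule (PowerSeries F) (Fin n → LaurentSeries F) :=
  Submodule.span _ (Set.range (Pi.basisFun (LaurentSeries F) (Fin n)))

instance : Submodule.IsLattice (LaurentSeries F) (powerSeriesLattice F n) where
  fg := Submodule.fg_span (Set.finite_range _)
  span_eq_top := by
    rw [powerSeriesLattice, Submodule.span_span_of_tower, Module.Basis.span_eq]

lemma mem_powerSeriesLattice {y : Fin n → LaurentSeries F} :
    y ∈ powerSeriesLattice F n ↔ ∀ i, ∀ j < 0, (y i).coeff j = 0 := by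
  simp only [powerSeriesLattice, Module.Basis.mem_span_iff_repr_mem, Pi.basisFun_repr,
    mem_range_algebraMap_iff]

lemma mem_X_smul_powerSeriesLattice {y : Fin n → LaurentSeries F} :
    y ∈ (X : PowerSeries F) • powerSeriesLattice F n ↔ ∀ i, ∀ j < 1, (y i).coeff j = 0 := by
  have coeff_X_smul (z : LaurentSeries F) (j : ℤ) :
      ((X : PowerSeries F) • z).coeff j = z.coeff (j - 1) := by
    rw [Algebra.smul_def, LaurentSeries.coe_algebraMap, PowerSeries.coe_X,
      HahnSeries.coeff_single_mul, one_mul]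
  constructor
  · rintro ⟨z, hz, rfl⟩ i j hj
    exact (coeff_X_smul _ _).trans (mem_powerSeriesLattice.1 hz i _ (by omega))
  · intro h
    refine ⟨fun i => HahnSeries.single (-1) 1 * y i, mem_powerSeriesLattice.2 fun i j hj => ?_, ?_⟩
    · rw [HahnSeries.coeff_single_mul, one_mul]
      exact h i _ (by omega)
    · funext i
      ext j
      refine (coeff_X_smul _ _).trans ?_
      rw [HahnSeries.coeff_single_mul, one_mul]
      congr 1
      ring

end PowerSeriesLattice

section Separation

lemma pow_le_tychonoffDist_iff {S : Type*} {c c' : ℤ → S} {m : ℕ} :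
    (1 / 2 : ℝ) ^ m ≤ tychonoffDist c c' ↔ ∃ j : ℤ, j.natAbs ≤ m ∧ c j ≠ c' j := by
  unfold tychonoffDist
  split_ifs with h
  · subst h
    simp only [ne_eq, not_true_eq_false, and_false, exists_false, iff_false, not_le]
    positivity
  · rw [pow_le_pow_iff_right_of_lt_one₀ (by norm_num) (by norm_num)]
    obtain ⟨j₀, hj₀⟩ := Function.ne_iff.1 h
    constructor
    · intro hm
      obtain ⟨j, hj, hne⟩ := Nat.sInf_mem (s := {m : ℕ | ∃ j : ℤ, j.natAbs = m ∧ c j ≠ c' j})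
        ⟨_, j₀, rfl, hj₀⟩
      exact ⟨j, hj.trans_le hm, hne⟩
    · rintro ⟨j, hj, hne⟩
      exact le_trans (Nat.sInf_le (by exact ⟨j, rfl, hne⟩)) hj

lemma positivelyExpansive_iff {S : Type*} {F : (ℤ → S) → (ℤ → S)} :
    PositivelyExpansive F ↔ ∃ m : ℕ, ∀ c c' : ℤ → S,
      (∀ l : ℕ, ∀ j : ℤ, j.natAbs ≤ m → F^[l] c j = F^[l] c' j) → c = c' := by
  constructor
  · rintro ⟨ε, hε, h⟩
    obtain ⟨m, hm⟩ := exists_pow_lt_of_lt_one hε (show (1 / 2 : ℝ) < 1 by norm_num)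
    refine ⟨m, fun c c' hc => by_contra fun hne => ?_⟩
    obtain ⟨l, hl⟩ := h c c' hne
    obtain ⟨j, hj, hj'⟩ := pow_le_tychonoffDist_iff.1 (hm.le.trans hl)
    exact hj' (hc l j hj)
  · rintro ⟨m, h⟩
    refine ⟨(1 / 2) ^ m, by positivity, fun c c' hne => ?_⟩
    simp_rw [pow_le_tychonoffDist_iff]
    by_contra! hcon
    exact hne (h c c' hcon)

lemma positivelyExpansive_addMonoidHom_iff {G : Type*} [AddGroup G] (Φ : (ℤ → G) →+ (ℤ → G)) :
    PositivelyExpansive Φ ↔ ∃ m : ℕ, ∀ c : ℤ → G,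
      (∀ l : ℕ, ∀ j : ℤ, j.natAbs ≤ m → Φ^[l] c j = 0) → c = 0 := by
  rw [positivelyExpansive_iff]
  refine exists_congr fun m => ⟨fun h c hc => h c 0 ?_, fun h c c' hc => sub_eq_zero.1 (h _ ?_)⟩
  · simpa only [iterate_map_zero, Pi.zero_apply] using hc
  · simpa only [iterate_map_sub, Pi.sub_apply, sub_eq_zero] using hc

end Separation

section GlobalRule

variable {S : Type*} {r : ℕ} (f : (Fin (2 * r + 1) → S) → S)

lemma globalRule_iterate_shift (a : ℤ) (l : ℕ) (c : ℤ → S) :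
    (globalRule r f)^[l] (fun j => c (j + a)) = fun j => (globalRule r f)^[l] c (j + a) := by
  have hcomm : Function.Semiconj (fun c j => c (j + a)) (globalRule r f) (globalRule r f) :=
    fun c => by
      funext j
      exact congrArg f (funext fun t => congrArg c (by ring))
  exact ((hcomm.iterate_right l).eq c).symm

/-- The local rule with the two directions of the line exchanged. -/
def revRule : (Fin (2 * r + 1) → S) → S :=
  fun w => f (w ∘ Fin.rev)

lemma semiconj_revRule :
    Function.Semiconj (fun c j => c (-j)) (globalRule r f) (globalRule r (revRule f)) := by
  intro c
  funext j
  refine congrArg f (funext fun t => congrArg c ?_)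
  rw [Fin.val_rev]
  omega

lemma globalRule_revRule_iterate (l : ℕ) (c : ℤ → S) :
    (globalRule r (revRule f))^[l] (fun j => c (-j)) =
      fun j => (globalRule r f)^[l] c (-j) :=
  (((semiconj_revRule f).iterate_right l).eq c).symm

lemma revRule_revRule : revRule (revRule f) = f :=
  funext fun w => congrArg f <| by
    rw [Function.comp_assoc, Fin.rev_involutive.comp_self, Function.comp_id]

variable {f}

lemma PositivelyExpansive.revRule (h : PositivelyExpansive (globalRule r f)) :
    PositivelyExpansive (globalRule r (revRule f)) := by
  obtain ⟨m, h⟩ := positivelyExpansive_iff.1 h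
  refine positivelyExpansive_iff.2 ⟨m, fun c c' hc => ?_⟩
  have key := h (fun j => c (-j)) (fun j => c' (-j)) fun l j hj => by
    rw [← revRule_revRule f, globalRule_revRule_iterate, globalRule_revRule_iterate]
    exact hc l (-j) (by rwa [Int.natAbs_neg])
  funext j
  simpa only [neg_neg] using congrFun key (-j)

lemma continuous_globalRule [TopologicalSpace S] [DiscreteTopology S] :
    Continuous (globalRule r f) :=
  continuous_pi fun _ => (continuous_of_discreteTopology (f := f)).comp
    (continuous_pi fun _ => continuous_apply _)

end GlobalRule

section Additive

variable {G : Type*} [AddCommGroup G] {r : ℕ} {f : (Fin (2 * r + 1) → G) → G}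

/-- The global rule of an additive local rule, as a homomorphism. -/
def caHom (hf : IsAdditive r f) : (ℤ → G) →+ (ℤ → G) :=
  AddMonoidHom.mk' (globalRule r f) hf

lemma coe_caHom (hf : IsAdditive r f) : ⇑(caHom hf) = globalRule r f := rfl

lemma IsAdditive.revRule (hf : IsAdditive r f) : IsAdditive r (revRule f) := by
  have eq_conj (c : ℤ → G) :
      globalRule r (AdditiveCA.revRule f) c = fun j => globalRule r f (fun j => c (-j)) (-j) := by
    simpa only [neg_neg] using ((semiconj_revRule f).eq fun j => c (-j)).symm
  intro c c'
  simp only [eq_conj]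
  funext j
  exact congrFun (hf (fun j => c (-j)) fun j => c' (-j)) (-j)

lemma localRule_add (hf : IsAdditive r f) (w w' : Fin (2 * r + 1) → G) :
    f (w + w') = f w + f w' := by
  let ext (w : Fin (2 * r + 1) → G) (j : ℤ) : G :=
    if h : (j + r).toNat < 2 * r + 1 then w ⟨(j + r).toNat, h⟩ else 0
  have globalRule_ext (w) : globalRule r f (ext w) 0 = f w := by
    refine congrArg f (funext fun t => ?_)
    have ht : (0 + ((t : ℕ) : ℤ) - r + r).toNat = t := by omega
    simp only [ext, ht]
    exact dif_pos t.2
  have ext_add : ext (w + w') = ext w + ext w' := by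
    funext j
    simp only [ext, Pi.add_apply]
    split_ifs
    · rfl
    · rw [add_zero]
  rw [← globalRule_ext w, ← globalRule_ext w', ← globalRule_ext (w + w'), ← Pi.add_apply, ← hf,
    ext_add]

/-- An additive local rule, as a homomorphism. -/
def localHom (hf : IsAdditive r f) : (Fin (2 * r + 1) → G) →+ G :=
  AddMonoidHom.mk' f (localRule_add hf)

lemma localRule_zero (hf : IsAdditive r f) : f 0 = 0 := map_zero (localHom hf)

/-- The summand of an additive local rule belonging to one position of the word. -/
def localPart (hf : IsAdditive r f) (t : Fin (2 * r + 1)) : G →+ G :=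
  (localHom hf).comp (AddMonoidHom.single (fun _ => G) t)

lemma localRule_eq_sum (hf : IsAdditive r f) (w : Fin (2 * r + 1) → G) :
    f w = ∑ t, localPart hf t (w t) := by
  conv_lhs => rw [← Finset.univ_sum_single w]
  exact map_sum (localHom hf) _ _

lemma globalRule_iterate_nsmul (hf : IsAdditive r f) (l m : ℕ) (c : ℤ → G) :
    (globalRule r f)^[l] (m • c) = m • (globalRule r f)^[l] c :=
  iterate_map_nsmul (caHom hf) l c m

end Additive

section TorsionSeries

open PowerSeries LaurentSeries
open scoped Pointwise

variable {G : Type*} [AddCommGroup G] {r : ℕ} {f : (Fin (2 * r + 1) → G) → G}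

/-- Within `N` steps, the negative half-line detects every `p`-torsion configuration that does
not vanish at the origin. -/
def HalfLineDetects (F : (ℤ → G) → (ℤ → G)) (p N : ℕ) : Prop :=
  ∀ c : ℤ → G, p • c = 0 → (∀ i ≤ N, ∀ j < 0, F^[i] c j = 0) → c 0 = 0

/-- The subgroup of `p`-torsion elements. -/
abbrev pTorsion (G : Type*) [AddCommGroup G] (p : ℕ) : AddSubgroup G :=
  (nsmulAddMonoidHom (α := G) p).ker

lemma nsmul_pTorsion (p : ℕ) (v : pTorsion G p) : p • v = 0 :=
  Subtype.ext v.2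

/-- The `p`-torsion as a vector space over the prime field. -/
abbrev pTorsionModule (G : Type*) [AddCommGroup G] (p : ℕ) : Module (ZMod p) (pTorsion G p) :=
  AddCommGroup.zmodModule (nsmul_pTorsion p)

attribute [local instance] pTorsionModule

/-- The restriction of a summand of the local rule to the `p`-torsion. -/
def torsionPart (hf : IsAdditive r f) (p : ℕ) (t : Fin (2 * r + 1)) :
    pTorsion G p →ₗ[ZMod p] pTorsion G p :=
  (((localPart hf t).comp (pTorsion G p).subtype).codRestrict (pTorsion G p) fun v => by
    rw [AddMonoidHom.mem_ker, nsmulAddMonoidHom_apply, ← map_nsmul,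
      nsmul_pTorsion, map_zero]).toZModLinearMap p

lemma coe_torsionPart (hf : IsAdditive r f) (p : ℕ) (t : Fin (2 * r + 1)) (v : pTorsion G p) :
    (torsionPart hf p t v : G) = localPart hf t v := rfl

variable {p n : ℕ} [Fact p.Prime] (b : Module.Basis (Fin n) (ZMod p) (pTorsion G p))

/-- The configuration over the `p`-torsion given by a vector of Laurent series. -/
noncomputable def seriesConfig (y : Fin n → LaurentSeries (ZMod p)) (j : ℤ) : G :=
  (b.equivFun.symm fun i => (y i).coeff j : pTorsion G p)

lemma seriesConfig_eq_zero_iff (y : Fin n → LaurentSeries (ZMod p)) (j : ℤ) :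
    seriesConfig b y j = 0 ↔ ∀ i, (y i).coeff j = 0 := by
  rw [seriesConfig, ZeroMemClass.coe_eq_zero, LinearEquiv.map_eq_zero_iff]
  exact funext_iff

lemma mem_powerSeriesLattice_iff_seriesConfig {y : Fin n → LaurentSeries (ZMod p)} :
    y ∈ powerSeriesLattice (ZMod p) n ↔ ∀ j < 0, seriesConfig b y j = 0 := by
  simp only [mem_powerSeriesLattice, seriesConfig_eq_zero_iff]
  exact ⟨fun h j hj i => h i j hj, fun h i j hj => h j hj i⟩

lemma mem_X_smul_powerSeriesLattice_iff_seriesConfig {y : Fin n → LaurentSeries (ZMod p)} :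
    y ∈ (X : PowerSeries (ZMod p)) • powerSeriesLattice (ZMod p) n ↔
      ∀ j < 1, seriesConfig b y j = 0 := by
  simp only [mem_X_smul_powerSeriesLattice, seriesConfig_eq_zero_iff]
  exact ⟨fun h j hj i => h i j hj, fun h i j hj => h j hj i⟩

lemma nsmul_seriesConfig (y : Fin n → LaurentSeries (ZMod p)) : p • seriesConfig b y = 0 :=
  funext fun j => (b.equivFun.symm fun i => (y i).coeff j : pTorsion G p).2

lemma exists_seriesConfig_eq {c : ℤ → G} (hc : p • c = 0) (h0 : ∀ j < 0, c j = 0) :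
    ∃ y, seriesConfig b y = c := by
  let v (j : ℤ) : pTorsion G p := ⟨c j, congrFun hc j⟩
  refine ⟨fun i => HahnSeries.ofSuppBddBelow (fun j => b.equivFun (v j) i) ⟨0, fun j hj => ?_⟩,
    funext fun j => congrArg Subtype.val (b.equivFun.symm_apply_apply (v j))⟩
  by_contra! hneg
  have hv : v j = 0 := Subtype.ext (h0 j hneg)
  exact hj (by simp only [hv, map_zero, Pi.zero_apply])

/-- The matrix of Laurent polynomials by which the automaton acts on the `p`-torsion. -/
noncomputable def seriesMatrix (hf : IsAdditive r f) :
    Matrix (Fin n) (Fin n) (LaurentSeries (ZMod p)) :=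
  Matrix.of fun i l => ∑ t : Fin (2 * r + 1),
    HahnSeries.single ((r : ℤ) - (t : ℕ)) (LinearMap.toMatrix b b (torsionPart hf p t) i l)

lemma coeff_seriesMatrix_mulVec (hf : IsAdditive r f) (y : Fin n → LaurentSeries (ZMod p))
    (a : ℤ) :
    (fun i => ((seriesMatrix b hf).mulVec y i).coeff a) =
      ∑ t : Fin (2 * r + 1), b.equivFun (torsionPart hf p t
        (b.equivFun.symm fun i => (y i).coeff (a + (t : ℕ) - r))) := by
  funext i
  rw [Finset.sum_apply]
  simp only [Matrix.mulVec, dotProduct, seriesMatrix, Matrix.of_apply, HahnSeries.coeff_sum,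
    Finset.sum_mul, HahnSeries.coeff_single_mul]
  rw [Finset.sum_comm]
  refine Finset.sum_congr rfl fun t _ => ?_
  rw [Module.Basis.equivFun_apply, ← LinearMap.toMatrix_mulVec_repr b b]
  simp only [Matrix.mulVec, dotProduct, ← Module.Basis.equivFun_apply,
    LinearEquiv.apply_symm_apply, sub_sub_eq_add_sub]

lemma semiconj_seriesConfig (hf : IsAdditive r f) :
    Function.Semiconj (seriesConfig b) (Matrix.toLin' (seriesMatrix b hf)) (globalRule r f) := by
  intro y
  funext a
  rw [seriesConfig, Matrix.toLin'_apply, coeff_seriesMatrix_mulVec, map_sum,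
    AddSubgroup.val_finsetSum, globalRule, localRule_eq_sum hf]
  refine Finset.sum_congr rfl fun t _ => ?_
  rw [LinearEquiv.symm_apply_apply, coe_torsionPart]
  rfl

lemma expansiveAt_iff_halfLineDetects (hf : IsAdditive r f) (N : ℕ) :
    ExpansiveAt (powerSeriesLattice (ZMod p) n) X (Matrix.toLin' (seriesMatrix b hf)) N ↔
      HalfLineDetects (globalRule r f) p N := by
  have seriesConfig_pow (i : ℕ) (y : Fin n → LaurentSeries (ZMod p)) :
      seriesConfig b ((Matrix.toLin' (seriesMatrix b hf) ^ i) y) =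
        (globalRule r f)^[i] (seriesConfig b y) := by
    rw [Module.End.pow_apply]
    exact ((semiconj_seriesConfig b hf).iterate_right i).eq y
  simp only [ExpansiveAt, mem_powerSeriesLattice_iff_seriesConfig b, seriesConfig_pow,
    mem_X_smul_powerSeriesLattice_iff_seriesConfig b]
  constructor
  · intro h c hc hN
    obtain ⟨y, rfl⟩ := exists_seriesConfig_eq b hc (hN 0 (Nat.zero_le N))
    exact h y hN 0 zero_lt_one
  · intro h y hN j hj
    obtain hneg | rfl : j < 0 ∨ j = 0 := by omega
    · exact hN 0 (Nat.zero_le N) j hneg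
    · exact h _ (nsmul_seriesConfig b y) hN

lemma HalfLineDetects.mono {F : (ℤ → G) → (ℤ → G)} {p N N' : ℕ} (hN : N ≤ N')
    (h : HalfLineDetects F p N) : HalfLineDetects F p N' :=
  fun c hc hc' => h c hc fun i hi => hc' i (hi.trans hN)

lemma finrank_pTorsion_le_card [Finite G] :
    Module.finrank (ZMod p) (pTorsion G p) ≤ Nat.card G := calc
  Module.finrank (ZMod p) (pTorsion G p) ≤ p ^ Module.finrank (ZMod p) (pTorsion G p) :=
    (Nat.lt_pow_self (Fact.out : p.Prime).one_lt).le
  _ = Nat.card (pTorsion G p) := by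
    rw [Module.natCard_eq_pow_finrank (K := ZMod p) (V := pTorsion G p), Nat.card_zmod]
  _ ≤ Nat.card G := Nat.card_le_card_of_injective _ Subtype.val_injective

lemma HalfLineDetects.natCard [Finite G] (hf : IsAdditive r f) {L : ℕ}
    (h : HalfLineDetects (globalRule r f) p L) :
    HalfLineDetects (globalRule r f) p (Nat.card G) := by
  have : Module.Finite (ZMod p) (pTorsion G p) := Module.Finite.of_finite
  let b := Module.finBasis (ZMod p) (pTorsion G p)
  have hdim := ((expansiveAt_iff_halfLineDetects b hf L).2 h).expansiveAt_finrank X_irreducible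
  rw [Module.finrank_fin_fun] at hdim
  exact ((expansiveAt_iff_halfLineDetects b hf _).1 hdim).mono finrank_pTorsion_le_card

end TorsionSeries

section Detection

variable {G : Type*} [AddCommGroup G] {r : ℕ} {f : (Fin (2 * r + 1) → G) → G} {p N : ℕ}

lemma PositivelyExpansive.eq_zero_of_halfLine (hf : IsAdditive r f)
    (h : PositivelyExpansive (globalRule r f)) {c : ℤ → G}
    (hc : ∀ l, ∀ j < 0, (globalRule r f)^[l] c j = 0) : c = 0 := by
  obtain ⟨m, hm⟩ := (positivelyExpansive_addMonoidHom_iff (caHom hf)).1 h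
  have hshift := hm (fun j => c (j + (-(m + 1 : ℕ)))) fun l j hj => by
    rw [coe_caHom, globalRule_iterate_shift]
    exact hc l _ (by omega)
  funext j
  simpa only [add_neg_cancel_right, Pi.zero_apply] using congrFun hshift (j + (m + 1 : ℕ))

lemma exists_halfLineDetects [Finite G]
    (h : ∀ c, (∀ l, ∀ j < 0, (globalRule r f)^[l] c j = 0) → c = 0) (p : ℕ) :
    ∃ N, HalfLineDetects (globalRule r f) p N := by
  let _ : TopologicalSpace G := ⊥
  have : DiscreteTopology G := ⟨rfl⟩
  by_contra! hcon
  let K (N : ℕ) : Set (ℤ → G) :=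
    {c | c 0 ≠ 0} ∩ ⋂ i ∈ Set.Iic N, ⋂ j ∈ Set.Iio (0 : ℤ), {c | (globalRule r f)^[i] c j = 0}
  have hclosed (N : ℕ) : IsClosed (K N) :=
    ((isClosed_discrete {x : G | x ≠ 0}).preimage
      (continuous_apply (A := fun _ : ℤ => G) 0)).inter <|
      isClosed_biInter fun i _ => isClosed_biInter fun j _ =>
        (isClosed_discrete {0}).preimage <|
          (continuous_apply j).comp (continuous_globalRule.iterate i)
  have hanti (N : ℕ) : K (N + 1) ⊆ K N := Set.inter_subset_inter_right _ <|
    Set.biInter_subset_biInter_left <| Set.Iic_subset_Iic.2 N.le_succ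
  have hne (N : ℕ) : (K N).Nonempty := by
    have hN := hcon N
    simp only [HalfLineDetects, not_forall] at hN
    obtain ⟨c, -, hc, h0⟩ := hN
    exact ⟨c, h0, Set.mem_iInter₂.2 fun i hi => Set.mem_iInter₂.2 fun j hj => hc i hi j hj⟩
  obtain ⟨c, hc⟩ := IsCompact.nonempty_iInter_of_sequence_nonempty_isCompact_isClosed K
    hanti hne (hclosed 0).isCompact hclosed
  rw [Set.mem_iInter] at hc
  refine (hc 0).1 (congrFun (h c fun l j hj => ?_) 0)
  have hl := (hc l).2
  simp only [Set.mem_iInter] at hl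
  exact hl l Set.self_mem_Iic j hj

/-- Within `N` steps, the strip `[-r, r]` detects every `p`-torsion configuration that does not
vanish at both cells next to the strip. -/
def StripDetects (F : (ℤ → G) → (ℤ → G)) (r p N : ℕ) : Prop :=
  ∀ c : ℤ → G, p • c = 0 → (∀ i ≤ N, ∀ j : ℤ, j.natAbs ≤ r → F^[i] c j = 0) →
    c (r + 1) = 0 ∧ c (-(r + 1)) = 0

lemma globalRule_indicator (hf : IsAdditive r f) {c : ℤ → G}
    (hc : ∀ j : ℤ, j.natAbs ≤ r → c j = 0) :
    globalRule r f ((Set.Ioi 0).indicator c) = (Set.Ioi 0).indicator (globalRule r f c) := by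
  funext j
  by_cases hj : j ∈ Set.Ioi (0 : ℤ)
  · rw [Set.indicator_of_mem hj]
    refine congrArg f (funext fun t => ?_)
    rw [Set.mem_Ioi] at hj
    exact Set.indicator_apply_eq_self.2 fun h => hc _ (by rw [Set.mem_Ioi] at h; omega)
  · rw [Set.indicator_of_notMem hj]
    refine (congrArg f (funext fun t => ?_)).trans (localRule_zero hf)
    rw [Set.mem_Ioi] at hj
    exact Set.indicator_apply_eq_zero.2 fun h => hc _ (by rw [Set.mem_Ioi] at h; omega)

/-- What lies to the right of a strip of zeros evolves on its own. -/
lemma HalfLineDetects.eq_zero_of_strip (hf : IsAdditive r f)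
    (h : HalfLineDetects (globalRule r f) p N) {c : ℤ → G} (hpc : p • c = 0)
    (hc : ∀ i ≤ N, ∀ j : ℤ, j.natAbs ≤ r → (globalRule r f)^[i] c j = 0) : c (r + 1) = 0 := by
  have iterate_indicator (i : ℕ) (hi : i ≤ N) : (globalRule r f)^[i] ((Set.Ioi 0).indicator c) =
      (Set.Ioi 0).indicator ((globalRule r f)^[i] c) := by
    induction i with
    | zero => rfl
    | succ i ih =>
      rw [Function.iterate_succ_apply', ih (by omega), globalRule_indicator hf (hc i (by omega)),
        Function.iterate_succ_apply']
  have indicator_torsion : p • (Set.Ioi (0 : ℤ)).indicator c = 0 :=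
    (Set.indicator_const_smul _ p c).symm.trans <|
      (congrArg _ hpc).trans (Set.indicator_zero G _)
  have hshift := h (fun j => (Set.Ioi 0).indicator c (j + (r + 1)))
    (funext fun j => congrFun indicator_torsion (j + (r + 1))) fun i hi j hj => ?_
  · rwa [zero_add, Set.indicator_of_mem (Set.mem_Ioi.2 (by positivity))] at hshift
  · rw [globalRule_iterate_shift, iterate_indicator i hi]
    exact Set.indicator_apply_eq_zero.2 fun h => hc i hi _ (by rw [Set.mem_Ioi] at h; omega)

lemma stripDetects_of_halfLineDetects (hf : IsAdditive r f)
    (h : HalfLineDetects (globalRule r f) p N)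
    (h' : HalfLineDetects (globalRule r (revRule f)) p N) :
    StripDetects (globalRule r f) r p N := by
  refine fun c hpc hc => ⟨h.eq_zero_of_strip hf hpc hc, ?_⟩
  refine h'.eq_zero_of_strip hf.revRule (c := fun j => c (-j))
    (funext fun j => congrFun hpc (-j)) fun i hi j hj => ?_
  rw [globalRule_revRule_iterate]
  exact hc i hi _ (by rwa [Int.natAbs_neg])

lemma exists_prime_nsmul {M : Type*} [AddCommGroup M] {N : ℕ} (hN : N ≠ 0) {c : M}
    (hc : N • c = 0) (hne : c ≠ 0) : ∃ p ∈ N.primeFactors, ∃ m : ℕ, p • m • c = 0 ∧ m • c ≠ 0 := by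
  have hdvd : addOrderOf c ∣ N := addOrderOf_dvd_of_nsmul_eq_zero hc
  obtain ⟨p, hp, m, hm⟩ := Nat.exists_prime_and_dvd
    (mt AddMonoid.addOrderOf_eq_one_iff.1 hne)
  have hm0 : m ≠ 0 := by rintro rfl; exact hN (Nat.eq_zero_of_zero_dvd (by simpa [hm] using hdvd))
  refine ⟨p, Nat.mem_primeFactors.2 ⟨hp, (Dvd.intro m hm.symm).trans hdvd, hN⟩, m, ?_, fun h => ?_⟩
  · rw [← mul_nsmul', ← hm, addOrderOf_nsmul_eq_zero]
  · have hle := Nat.le_of_dvd (Nat.pos_of_ne_zero hm0) (addOrderOf_dvd_of_nsmul_eq_zero h)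
    rw [hm] at hle
    exact hle.not_gt (lt_mul_left (Nat.pos_of_ne_zero hm0) hp.one_lt)

lemma StripDetects.eq_zero (hf : IsAdditive r f) (h : StripDetects (globalRule r f) r p N)
    {c : ℤ → G} (hpc : p • c = 0)
    (hc : ∀ l, ∀ j : ℤ, j.natAbs ≤ r → (globalRule r f)^[l] c j = 0) : c = 0 := by
  have hzero (s : ℕ) : ∀ l, ∀ j : ℤ, j.natAbs ≤ r + s → (globalRule r f)^[l] c j = 0 := by
    induction s with
    | zero => exact hc
    | succ s ih =>
      intro l j hj
      have next (a : ℤ) (ha : a.natAbs ≤ s) := h (fun j => (globalRule r f)^[l] c (j + a)) (by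
          funext j
          refine (congrFun (globalRule_iterate_nsmul hf l p c) (j + a)).symm.trans ?_
          rw [hpc, ← coe_caHom hf, iterate_map_zero]; rfl) fun i _ j hj => by
        rw [globalRule_iterate_shift, ← Function.iterate_add_apply]
        exact ih _ _ (by omega)
      obtain hle | rfl | rfl : j.natAbs ≤ r + s ∨ j = r + 1 + s ∨ j = -(r + 1) + -s := by omega
      · exact ih l j hle
      · exact (next s (by omega)).1
      · exact (next (-s) (by omega)).2
  funext j
  exact hzero j.natAbs 0 j (by omega)

theorem positivelyExpansive_iff_stripDetects [Finite G] (hf : IsAdditive r f) :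
    PositivelyExpansive (globalRule r f) ↔
      ∀ p ∈ (Nat.card G).primeFactors, StripDetects (globalRule r f) r p (Nat.card G) := by
  constructor
  · intro h p hp
    have : Fact p.Prime := ⟨Nat.prime_of_mem_primeFactors hp⟩
    obtain ⟨L, hL⟩ := exists_halfLineDetects (fun _ => h.eq_zero_of_halfLine hf) p
    obtain ⟨L', hL'⟩ :=
      exists_halfLineDetects (fun _ => h.revRule.eq_zero_of_halfLine hf.revRule) p
    exact stripDetects_of_halfLineDetects hf (hL.natCard hf) (hL'.natCard hf.revRule)
  · intro h
    refine (positivelyExpansive_addMonoidHom_iff (caHom hf)).2 ⟨r, fun c hc => ?_⟩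
    by_contra hne
    obtain ⟨p, hp, m, hpm, hmc⟩ := exists_prime_nsmul (N := Nat.card G) Nat.card_pos.ne'
      (funext fun j => card_nsmul_eq_zero') hne
    refine hmc ((h p hp).eq_zero hf hpm fun l j hj => ?_)
    rw [globalRule_iterate_nsmul hf, Pi.smul_apply, ← coe_caHom hf, hc l j hj, smul_zero]

end Detection

section Diagrams

variable {G : Type*} [AddCommGroup G] {r p N : ℕ} {f : (Fin (2 * r + 1) → G) → G}

/-- The number of cells on which the states of `2 * r + 3` consecutive cells during `N` steps
depend. -/
def windowWidth (r N : ℕ) : ℕ := 2 * (r * N) + (2 * r + 3)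

/-- `X` is a finite space-time diagram violating `StripDetects`: `X i j` is the state of cell `j`
of the window at time `i`, and the strip consists of the `2 * r + 1` central cells. -/
def IsStripDiagram (f : (Fin (2 * r + 1) → G) → G) (p N : ℕ) (X : ℕ → ℕ → G) : Prop :=
  (∀ i < N, ∀ j < 2 * (r * N) + 3, X (i + 1) (j + r) = f fun t => X i (j + t)) ∧
    (∀ j < windowWidth r N, p • X 0 j = 0) ∧
    (∀ i < N + 1, ∀ j < 2 * r + 1, X i (r * N + 1 + j) = 0) ∧
    ¬ (X 0 (r * N + (2 * r + 2)) = 0 ∧ X 0 (r * N) = 0)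

lemma IsStripDiagram.congr {X Y : ℕ → ℕ → G} (h : IsStripDiagram f p N X)
    (hXY : ∀ i < N + 1, ∀ j < windowWidth r N, X i j = Y i j) : IsStripDiagram f p N Y := by
  obtain ⟨step, torsion, strip, ne_zero⟩ := h
  unfold windowWidth at *
  refine ⟨fun i hi j hj => ?_, fun j hj => ?_, fun i hi j hj => ?_, ?_⟩
  · rw [← hXY _ (by omega) _ (by omega), step i hi j hj]
    exact congrArg f (funext fun t => hXY _ (by omega) _ (by omega))
  · rw [← hXY _ (by omega) _ hj, torsion j hj]
  · rw [← hXY _ hi _ (by omega), strip i hi j hj]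
  · rwa [← hXY _ (by omega) _ (by omega), ← hXY _ (by omega) _ (by omega)]

lemma exists_isStripDiagram_of_not_stripDetects (h : ¬ StripDetects (globalRule r f) r p N) :
    ∃ X, IsStripDiagram f p N X := by
  simp only [StripDetects, not_forall] at h
  obtain ⟨c, hpc, hc, hne⟩ := h
  refine ⟨fun i j => (globalRule r f)^[i] c (j - (r * N + r + 1 : ℕ)), fun i _ j _ => ?_,
    fun j _ => congrFun hpc _, fun i hi j hj => hc i (by omega) _ (by omega), ?_⟩
  · beta_reduce
    rw [Function.iterate_succ_apply', globalRule]
    exact congrArg f (funext fun t => congrArg _ (by push_cast; ring))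
  · convert hne using 3
    · exact congrArg c (by push_cast; ring)
    · exact congrArg c (by push_cast; ring)

lemma globalRule_iterate_eq_of_isStripDiagram {X : ℕ → ℕ → G} (h : IsStripDiagram f p N X)
    {c : ℤ → G} (hc : ∀ j < windowWidth r N, c j = X 0 j) {i j : ℕ} (hi : i ≤ N)
    (hj : r * i ≤ j) (hj' : j + r * i < windowWidth r N) :
    (globalRule r f)^[i] c j = X i j := by
  induction i generalizing j with
  | zero => exact hc j hj'
  | succ i ih =>
    have hriN : r * i + r ≤ r * N := by
      rw [← Nat.mul_succ]
      exact Nat.mul_le_mul_left r hi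
    rw [Nat.mul_succ] at hj hj'
    unfold windowWidth at hj' ih
    obtain ⟨j, rfl⟩ := Nat.exists_eq_add_of_le' (Nat.le_of_add_left_le hj)
    rw [h.1 i hi j (by omega), Function.iterate_succ_apply', globalRule]
    refine congrArg f (funext fun t => ?_)
    rw [← ih (by omega) (by omega) (by omega)]
    exact congrArg _ (by push_cast; ring)

lemma IsStripDiagram.not_stripDetects {X : ℕ → ℕ → G} (h : IsStripDiagram f p N X) :
    ¬ StripDetects (globalRule r f) r p N := by
  let c (j : ℤ) : G := if 0 ≤ j ∧ j < windowWidth r N then X 0 j.toNat else 0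
  have c_natCast (j : ℕ) (hj : j < windowWidth r N) : c j = X 0 j := by
    simp only [c, if_pos (⟨Int.natCast_nonneg j, Int.ofNat_lt.2 hj⟩ : 0 ≤ (j : ℤ) ∧ _),
      Int.toNat_natCast]
  have c_torsion (j : ℤ) : p • c j = 0 := by
    simp only [c]
    split_ifs with hj
    · exact h.2.1 _ (by omega)
    · exact smul_zero p
  intro hs
  have hcentre := hs (fun j => c (j + (r * N + r + 1 : ℕ))) (funext fun j => c_torsion _)
    fun i hi j hj => by
      have hri : r * i ≤ r * N := Nat.mul_le_mul_left r hi
      obtain ⟨k, hk⟩ : ∃ k : ℕ, j + (r * N + r + 1 : ℕ) = (r * N + 1 + k : ℕ) :=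
        ⟨(j + r).toNat, by omega⟩
      rw [globalRule_iterate_shift]
      beta_reduce
      rw [hk, globalRule_iterate_eq_of_isStripDiagram h c_natCast hi
        (by omega) (by unfold windowWidth; omega)]
      exact h.2.2.1 i (by omega) k (by omega)
  refine h.2.2.2 ⟨?_, ?_⟩
  · rw [← c_natCast _ (by unfold windowWidth; omega), ← hcentre.1]
    exact congrArg c (by push_cast; ring)
  · rw [← c_natCast _ (by unfold windowWidth; omega), ← hcentre.2]
    exact congrArg c (by push_cast; ring)

end Diagrams

namespace Code

/-- The order of the group. -/
def card (x : Code) : ℕ := x.1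

/-- The sum of two elements of the group, looked up in the addition table. -/
def add (x : Code) (a b : ℕ) : ℕ := (x.2.1.getD a []).getD b 0

/-- The radius of the automaton. -/
def radius (x : Code) : ℕ := x.2.2.1

/-- The value of the local rule at a word, looked up in its table. -/
def rule (x : Code) (w : ℕ) : ℕ := x.2.2.2.getD w 0

/-- The neutral element, characterized as the only idempotent. -/
def IsZero (x : Code) (a : ℕ) : Prop := x.add a a = a

/-- The state at time `i` of cell `j` in the space-time diagram encoded by `Z`. The diagram is read
off the digits of `Z` in base `x.card`, row after row. -/
def cell (x : Code) (Z i j : ℕ) : ℕ :=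
  Z / x.card ^ (windowWidth x.radius x.card * i + j) % x.card

/-- The word of length `2 * r + 1` that starts at cell `j` at time `i` in the space-time diagram
encoded by `Z`. -/
def word (x : Code) (Z i j : ℕ) : ℕ :=
  Z / x.card ^ (windowWidth x.radius x.card * i + j) % x.card ^ (2 * x.radius + 1)

/-- The space-time diagram encoded by `Z` satisfies `IsStripDiagram` with as many steps as the
group has elements. That `a` is a `p`-torsion element is expressed by `p • a + a = a`. -/
def IsCertificate (x : Code) (p Z : ℕ) : Prop :=
  (∀ i < x.card, ∀ j < 2 * (x.radius * x.card) + 3,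
      x.cell Z (i + 1) (j + x.radius) = x.rule (x.word Z i j)) ∧
    (∀ j < windowWidth x.radius x.card,
      (x.add (x.cell Z 0 j))^[p] (x.cell Z 0 j) = x.cell Z 0 j) ∧
    (∀ i < x.card + 1, ∀ j < 2 * x.radius + 1, x.IsZero (x.cell Z i (x.radius * x.card + 1 + j))) ∧
    ¬ (x.IsZero (x.cell Z 0 (x.radius * x.card + (2 * x.radius + 2))) ∧
      x.IsZero (x.cell Z 0 (x.radius * x.card)))

/-- Some space-time diagram certifies that the automaton is not positively expansive. -/
def HasCertificate (x : Code) : Prop :=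
  ∃ p < x.card + 1, (p.Prime ∧ x.card % p = 0) ∧
    ∃ Z < x.card ^ (windowWidth x.radius x.card * (x.card + 1)), x.IsCertificate p Z

end Code

section Primrec

variable {α : Type*} [Primcodable α]

lemma primrecPred_exists_lt {b : α → ℕ} {P : α → ℕ → Prop} (hb : Primrec b)
    (hP : PrimrecRel P) : PrimrecPred fun a => ∃ n < b a, P a n :=
  ((hP.comp₂ Primrec₂.right Primrec₂.left).exists_mem_list.comp
    (Primrec.list_range.comp hb) .id).of_eq (by simp)

lemma primrecPred_forall_lt {b : α → ℕ} {P : α → ℕ → Prop} (hb : Primrec b)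
    (hP : PrimrecRel P) : PrimrecPred fun a => ∀ n < b a, P a n :=
  ((hP.comp₂ Primrec₂.right Primrec₂.left).forall_mem_list.comp
    (Primrec.list_range.comp hb) .id).of_eq (by simp)

lemma primrec₂_pow : Primrec₂ ((· ^ ·) : ℕ → ℕ → ℕ) :=
  Primrec₂.unpaired'.1 Nat.Primrec.pow

lemma primrecPred_prime : PrimrecPred Nat.Prime := by
  refine PrimrecPred.of_eq (p := fun p => 2 ≤ p ∧ ∀ m < p, p % m ≠ 0 ∨ m = 1) (.and
    (Primrec.nat_le.comp (.const 2) .id) (primrecPred_forall_lt .id (.or (PrimrecPred.not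
      (Primrec.eq.comp (Primrec.nat_mod.comp .fst .snd) (.const 0)))
      (Primrec.eq.comp .snd (.const 1))))) fun p => ?_
  simp only [Nat.prime_def_lt, Nat.dvd_iff_mod_eq_zero, ne_eq, ← imp_iff_not_or]

lemma primrec_windowWidth : Primrec₂ windowWidth :=
  Primrec.nat_add.comp (Primrec.nat_mul.comp (.const 2) (Primrec.nat_mul.comp .fst .snd))
    (Primrec.nat_add.comp (Primrec.nat_mul.comp (.const 2) .fst) (.const 3))

lemma primrec_card : Primrec Code.card := .fst

lemma primrec_radius : Primrec Code.radius := Primrec.fst.comp (Primrec.snd.comp .snd)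

lemma primrec_rule : Primrec₂ Code.rule :=
  (Primrec.list_getD 0).comp (Primrec.snd.comp (Primrec.snd.comp (Primrec.snd.comp .fst))) .snd

lemma primrec_add {x : α → Code} {a b : α → ℕ} (hx : Primrec x) (ha : Primrec a)
    (hb : Primrec b) : Primrec fun y => (x y).add (a y) (b y) :=
  (Primrec.list_getD 0).comp
    ((Primrec.list_getD []).comp (Primrec.fst.comp (Primrec.snd.comp hx)) ha) hb

lemma primrecRel_isZero : PrimrecRel Code.IsZero :=
  Primrec.eq.comp (primrec_add .fst .snd .snd) .snd

variable {x : α → Code} {Z i j : α → ℕ}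

lemma primrec_div_card_pow (hx : Primrec x) (hZ : Primrec Z) (hi : Primrec i) (hj : Primrec j) :
    Primrec fun a =>
      Z a / (x a).card ^ (windowWidth (x a).radius (x a).card * i a + j a) :=
  have hcard := primrec_card.comp hx
  Primrec.nat_div.comp hZ (primrec₂_pow.comp hcard (Primrec.nat_add.comp (Primrec.nat_mul.comp
    (primrec_windowWidth.comp (primrec_radius.comp hx) hcard) hi) hj))

lemma primrec_cell (hx : Primrec x) (hZ : Primrec Z) (hi : Primrec i) (hj : Primrec j) :
    Primrec fun a => (x a).cell (Z a) (i a) (j a) :=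
  Primrec.nat_mod.comp (primrec_div_card_pow hx hZ hi hj) (primrec_card.comp hx)

lemma primrec_word (hx : Primrec x) (hZ : Primrec Z) (hi : Primrec i) (hj : Primrec j) :
    Primrec fun a => (x a).word (Z a) (i a) (j a) :=
  Primrec.nat_mod.comp (primrec_div_card_pow hx hZ hi hj) (primrec₂_pow.comp (primrec_card.comp hx)
    (Primrec.succ.comp (Primrec.nat_mul.comp (.const 2) (primrec_radius.comp hx))))

lemma primrecPred_isCertificate {p : α → ℕ} (hx : Primrec x) (hp : Primrec p) (hZ : Primrec Z) :
    PrimrecPred fun a => (x a).IsCertificate (p a) (Z a) := by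
  have hcard := primrec_card.comp hx
  have hr := primrec_radius.comp hx
  have hrq := Primrec.nat_mul.comp hr hcard
  have h2r := Primrec.nat_mul.comp (.const 2) hr
  have hα : Primrec fun y : (α × ℕ) × ℕ => y.1.1 := Primrec.fst.comp .fst
  have hi : Primrec fun y : (α × ℕ) × ℕ => y.1.2 := Primrec.snd.comp .fst
  refine .and ?step (.and ?torsion (.and ?strip (PrimrecPred.not (.and ?right ?left))))
  case step =>
    refine primrecPred_forall_lt hcard (primrecPred_forall_lt (Primrec.nat_add.comp
      (Primrec.nat_mul.comp (.const 2) (hrq.comp .fst)) (.const 3)) (Primrec.eq.comp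
      (primrec_cell (hx.comp hα) (hZ.comp hα) (Primrec.succ.comp hi)
        (Primrec.nat_add.comp .snd (hr.comp hα)))
      (primrec_rule.comp (hx.comp hα) (primrec_word (hx.comp hα) (hZ.comp hα) hi .snd))))
  case torsion =>
    have hcell : Primrec fun y : α × ℕ => (x y.1).cell (Z y.1) 0 y.2 :=
      primrec_cell (hx.comp .fst) (hZ.comp .fst) (.const 0) .snd
    exact primrecPred_forall_lt (primrec_windowWidth.comp hr hcard) (Primrec.eq.comp
      (Primrec.nat_iterate (hp.comp .fst) hcell
        (primrec_add ((hx.comp .fst).comp .fst) (hcell.comp .fst) .snd)) hcell)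
  case strip =>
    exact primrecPred_forall_lt (Primrec.succ.comp hcard) (primrecPred_forall_lt
      (Primrec.succ.comp (h2r.comp .fst)) (primrecRel_isZero.comp (hx.comp hα)
        (primrec_cell (hx.comp hα) (hZ.comp hα) hi
          (Primrec.nat_add.comp (Primrec.succ.comp (hrq.comp hα)) .snd))))
  case right =>
    exact primrecRel_isZero.comp hx (primrec_cell hx hZ (.const 0)
      (Primrec.nat_add.comp hrq (Primrec.nat_add.comp h2r (.const 2))))
  case left => exact primrecRel_isZero.comp hx (primrec_cell hx hZ (.const 0) hrq)

lemma primrecPred_hasCertificate : PrimrecPred Code.HasCertificate := by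
  have hx : Primrec fun y : Code × ℕ => y.1 := .fst
  have hcard := primrec_card.comp hx
  refine primrecPred_exists_lt (Primrec.succ.comp primrec_card) (.and (.and
    (primrecPred_prime.comp .snd) (Primrec.eq.comp (Primrec.nat_mod.comp hcard .snd) (.const 0)))
    (primrecPred_exists_lt ?_
      (primrecPred_isCertificate (hx.comp .fst) (Primrec.snd.comp .fst) .snd)))
  exact primrec₂_pow.comp hcard (Primrec.nat_mul.comp
    (primrec_windowWidth.comp (primrec_radius.comp hx) hcard) (Primrec.succ.comp hcard))

end Primrec

section Encoding

lemma getD_ofFn {α : Type*} {n : ℕ} (g : Fin n → α) (d : α) (i : Fin n) :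
    (List.ofFn g).getD i d = g i := by
  rw [List.getD_eq_getElem _ _ (by rw [List.length_ofFn]; exact i.2), List.getElem_ofFn]

lemma div_pow_mod_pow_div_pow_mod (Z q l : ℕ) {t m : ℕ} (h : t < m) :
    Z / q ^ l % q ^ m / q ^ t % q = Z / q ^ (l + t) % q := by
  obtain ⟨d, rfl⟩ := Nat.exists_eq_add_of_lt h
  rw [add_assoc, pow_add q t, Nat.mod_mul_right_div_self,
    Nat.mod_mod_of_dvd _ (dvd_pow_self q d.succ_ne_zero), Nat.div_div_eq_div_mul, ← pow_add]

variable {G : Type*} {q : ℕ} (e : G ≃ Fin q)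

section AddTable

variable [AddCommGroup G] {r : ℕ} (f : (Fin (2 * r + 1) → G) → G)

lemma add_encodeCA (a b : G) : (encodeCA e r f).add (e a) (e b) = e (a + b) := by
  simp only [Code.add, encodeCA, getD_ofFn, Equiv.symm_apply_apply]

lemma isZero_encodeCA (a : G) : (encodeCA e r f).IsZero (e a) ↔ a = 0 := by
  rw [Code.IsZero, add_encodeCA, ← Fin.ext_iff, e.injective.eq_iff, add_eq_left]

lemma add_iterate_encodeCA (p : ℕ) (a b : G) :
    ((encodeCA e r f).add (e a))^[p] (e b) = e (p • a + b) := by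
  induction p with
  | zero => rw [Function.iterate_zero_apply, zero_smul, zero_add]
  | succ p ih =>
    rw [Function.iterate_succ_apply', ih, add_encodeCA, succ_nsmul', add_assoc]

end AddTable

variable [NeZero q]

/-- The space-time diagram over `G` encoded by the number `Z` in base `q`. -/
def decodeDiagram (r Z i j : ℕ) : G :=
  e.symm (Fin.ofNat q (Z / q ^ (windowWidth r q * i + j)))

lemma exists_decodeDiagram_eq (r : ℕ) (X : ℕ → ℕ → G) :
    ∃ Z < q ^ (windowWidth r q * (q + 1)),
      ∀ i < q + 1, ∀ j < windowWidth r q, decodeDiagram e r Z i j = X i j := by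
  let W := windowWidth r q
  let digits (l : Fin (W * (q + 1))) : Fin q := e (X (l / W) (l % W))
  refine ⟨finFunctionFinEquiv digits, (finFunctionFinEquiv digits).2, fun i hi j hj => ?_⟩
  have hl : W * i + j < W * (q + 1) := calc
    W * i + j < W * (i + 1) := by rw [Nat.mul_succ]; exact Nat.add_lt_add_left hj _
    _ ≤ W * (q + 1) := Nat.mul_le_mul_left W hi
  have hdigit := congrFun (finFunctionFinEquiv.symm_apply_apply digits) ⟨W * i + j, hl⟩
  refine (congrArg e.symm (hdigit.trans ?_)).trans (e.symm_apply_apply (X i j))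
  simp only [digits]
  rw [Nat.mul_add_div (Nat.zero_lt_of_lt hj), Nat.div_eq_of_lt hj, Nat.mul_add_mod,
    Nat.mod_eq_of_lt hj, add_zero]

variable [AddCommGroup G] {r : ℕ} (f : (Fin (2 * r + 1) → G) → G)

lemma cell_encodeCA (Z i j : ℕ) : (encodeCA e r f).cell Z i j = e (decodeDiagram e r Z i j) := by
  rw [decodeDiagram, e.apply_symm_apply]
  rfl

lemma rule_word_encodeCA (Z i j : ℕ) :
    (encodeCA e r f).rule ((encodeCA e r f).word Z i j) =
      e (f fun t => decodeDiagram e r Z i (j + t)) := by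
  refine (getD_ofFn _ 0 ⟨(encodeCA e r f).word Z i j,
    Nat.mod_lt _ (pow_pos (NeZero.pos q) _)⟩).trans ?_
  refine congrArg (fun w => (e (f w) : ℕ)) (funext fun t => congrArg e.symm (Fin.ext ?_))
  exact (div_pow_mod_pow_div_pow_mod Z q _ t.2).trans (by rw [add_assoc]; rfl)

lemma isCertificate_encodeCA_iff (p Z : ℕ) :
    (encodeCA e r f).IsCertificate p Z ↔ IsStripDiagram f p q (decodeDiagram e r Z) := by
  have hcard : (encodeCA e r f).card = q := rfl
  have hradius : (encodeCA e r f).radius = r := rfl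
  simp only [Code.IsCertificate, hcard, hradius, rule_word_encodeCA, cell_encodeCA,
    isZero_encodeCA, add_iterate_encodeCA, ← Fin.ext_iff, e.injective.eq_iff, add_eq_right,
    IsStripDiagram]

lemma exists_isCertificate_iff (p : ℕ) :
    (∃ Z < q ^ (windowWidth r q * (q + 1)), (encodeCA e r f).IsCertificate p Z) ↔
      ¬ StripDetects (globalRule r f) r p q := by
  simp only [isCertificate_encodeCA_iff]
  constructor
  · rintro ⟨Z, -, hZ⟩
    exact hZ.not_stripDetects
  · intro h
    obtain ⟨X, hX⟩ := exists_isStripDiagram_of_not_stripDetects h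
    obtain ⟨Z, hZ, hZX⟩ := exists_decodeDiagram_eq e r X
    exact ⟨Z, hZ, hX.congr fun i hi j hj => (hZX i hi j hj).symm⟩

variable {f}

lemma hasCertificate_encodeCA_iff (hf : IsAdditive r f) :
    (encodeCA e r f).HasCertificate ↔ ¬ PositivelyExpansive (globalRule r f) := by
  have : Finite G := Finite.of_equiv _ e.symm
  have mem_primeFactors (p : ℕ) : p ∈ q.primeFactors ↔ p < q + 1 ∧ p.Prime ∧ q % p = 0 := by
    rw [Nat.mem_primeFactors_of_ne_zero (NeZero.ne q), ← Nat.dvd_iff_mod_eq_zero]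
    exact ⟨fun h => ⟨Nat.lt_succ_of_le (Nat.le_of_dvd (NeZero.pos q) h.2), h⟩, And.right⟩
  have hcard : (encodeCA e r f).card = q := rfl
  have hradius : (encodeCA e r f).radius = r := rfl
  simp only [Code.HasCertificate, hcard, hradius, positivelyExpansive_iff_stripDetects hf,
    Nat.card_congr e, Nat.card_fin, not_forall, ← exists_isCertificate_iff e, mem_primeFactors,
    exists_prop, and_assoc]

end Encoding

theorem exists_computable_positivelyExpansive_decider :
    ∃ D : Code → Bool, Computable D ∧
      ∀ (G : Type*) [AddCommGroup G] (q : ℕ) (e : G ≃ Fin q) (r : ℕ)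
        (f : (Fin (2 * r + 1) → G) → G), IsAdditive r f →
        (D (encodeCA e r f) = true ↔ PositivelyExpansive (globalRule r f)) := by
  classical
  refine ⟨fun x => decide (¬ x.HasCertificate), primrecPred_hasCertificate.not.decide.to_comp,
    fun G _ q e r f hf => ?_⟩
  have : NeZero q := ⟨(e 0).pos.ne'⟩
  rw [decide_eq_true_iff, hasCertificate_encodeCA_iff e hf, not_not]

section Scaling

variable {m d n : ℕ}

/-- Multiplication of representatives by `d`, as a homomorphism `ℤ/m → ℤ/n` where `m * d = n`. -/
def scaleHom (h : m * d = n) : ZMod m →+ ZMod n :=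
  ZMod.lift m ⟨zmultiplesHom (ZMod n) (d : ZMod n), by
    rw [zmultiplesHom_apply, natCast_zsmul, nsmul_eq_mul, ← Nat.cast_mul, h, ZMod.natCast_self]⟩

lemma scaleHom_natCast (h : m * d = n) (x : ℕ) :
    scaleHom h (x : ZMod m) = ((x * d : ℕ) : ZMod n) := by
  rw [← Int.cast_natCast x]
  refine (ZMod.lift_coe m _ _).trans ?_
  rw [zmultiplesHom_apply, natCast_zsmul, nsmul_eq_mul, Nat.cast_mul]

lemma scaleHom_apply [NeZero m] (h : m * d = n) (x : ZMod m) :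
    scaleHom h x = ((x.val * d : ℕ) : ZMod n) := by
  rw [← scaleHom_natCast h, ZMod.natCast_zmod_val]

lemma scaleHom_injective [NeZero m] (h : m * d = n) (hd : d ≠ 0) :
    Function.Injective (scaleHom h) := by
  rw [injective_iff_map_eq_zero]
  intro x hx
  rw [scaleHom_apply, ZMod.natCast_eq_zero_iff, ← h] at hx
  rw [← ZMod.natCast_zmod_val x, ZMod.natCast_eq_zero_iff]
  exact Nat.dvd_of_mul_dvd_mul_right (Nat.pos_of_ne_zero hd) hx

lemma exists_scaleHom_eq [NeZero n] (h : m * d = n) {y : ZMod n} (hy : m • y = 0) :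
    ∃ x, scaleHom h x = y := by
  have hm : 0 < m := Nat.pos_of_ne_zero fun hm => NeZero.ne n (by rw [← h, hm, zero_mul])
  rw [← ZMod.natCast_zmod_val y, nsmul_eq_mul, ← Nat.cast_mul, ZMod.natCast_eq_zero_iff] at hy
  obtain ⟨x, hx⟩ := Nat.dvd_of_mul_dvd_mul_left hm (h.dvd.trans hy)
  exact ⟨x, by rw [scaleHom_natCast, mul_comm, ← hx, ZMod.natCast_zmod_val]⟩

variable (g : ZMod m →+ ZMod n)

lemma dvd_mul_val_map_one [NeZero n] : n ∣ m * (g 1).val := by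
  rw [← ZMod.natCast_eq_zero_iff, Nat.cast_mul, ZMod.natCast_zmod_val, ← nsmul_eq_mul, ← map_nsmul,
    nsmul_one, ZMod.natCast_self, map_zero]

lemma map_natCast_eq_val_map_one_mul [NeZero n] (x : ℕ) :
    g (x : ZMod m) = (((g 1).val * x : ℕ) : ZMod n) := by
  rw [← nsmul_one, map_nsmul, nsmul_eq_mul, Nat.cast_mul, ZMod.natCast_zmod_val, mul_comm]

end Scaling

section PrimePowers

variable {p a b c : ℕ} [NeZero p]

lemma pow_sub_dvd_val_map_one (g : ZMod (p ^ b) →+ ZMod (p ^ a)) :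
    p ^ (a - b) ∣ (g 1).val := by
  obtain hab | hba := le_total a b
  · simp only [Nat.sub_eq_zero_of_le hab, pow_zero, one_dvd]
  · refine Nat.dvd_of_mul_dvd_mul_left (Nat.pow_pos (Nat.pos_of_neZero p) : 0 < p ^ b) ?_
    rw [← pow_add, Nat.add_sub_cancel' hba]
    exact dvd_mul_val_map_one g

lemma pow_mul_div_pow_mul_pow {w : ℕ} (ha : a ≤ c) (hb : b ≤ c) (hw : p ^ (a - b) ∣ w) :
    p ^ (b - a) * w / p ^ (a - b) * p ^ (c - b) = w * p ^ (c - a) := by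
  obtain ⟨v, rfl⟩ := hw
  rw [mul_left_comm, Nat.mul_div_cancel_left _ (Nat.pow_pos (Nat.pos_of_neZero p)), mul_right_comm,
    mul_right_comm (p ^ (a - b)), ← pow_add, ← pow_add]
  congr 2
  omega

lemma entry_mul_scaleHom (g : ZMod (p ^ b) →+ ZMod (p ^ a))
    (ha : a ≤ c) (hb : b ≤ c) (x : ZMod (p ^ b)) :
    ((p ^ (b - a) * (g 1).val / p ^ (a - b) : ℕ) : ZMod (p ^ c)) *
        scaleHom (pow_mul_pow_sub p hb) x =
      scaleHom (pow_mul_pow_sub p ha) (g x) := by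
  conv_rhs => rw [← ZMod.natCast_zmod_val x, map_natCast_eq_val_map_one_mul, scaleHom_natCast]
  rw [scaleHom_apply, ← Nat.cast_mul, mul_left_comm,
    pow_mul_div_pow_mul_pow ha hb (pow_sub_dvd_val_map_one g), mul_right_comm, mul_comm]

end PrimePowers

section Psi

variable {p n : ℕ} [NeZero p] [NeZero n] {k : Fin n → ℕ}

/-- The map `ψ`, as a homomorphism. -/
def psiHom (hk : ∀ i, k i ≤ k 0) : PGroup p k →+ Fin n → ZMod (p ^ k 0) :=
  AddMonoidHom.pi fun i =>
    (scaleHom (pow_mul_pow_sub p (hk i))).comp (Pi.evalAddMonoidHom (fun i => ZMod (p ^ k i)) i)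

lemma coe_psiHom (hk : ∀ i, k i ≤ k 0) : ⇑(psiHom (p := p) hk) = psi p k := by
  funext h i
  exact scaleHom_apply (pow_mul_pow_sub p (hk i)) (h i)

lemma psi_apply (hk : ∀ i, k i ≤ k 0) (h : PGroup p k) (i : Fin n) :
    psi p k h i = scaleHom (pow_mul_pow_sub p (hk i)) (h i) := by
  rw [← coe_psiHom hk]
  rfl

lemma psi_injective (hk : ∀ i, k i ≤ k 0) : Function.Injective (psi p k) := by
  intro h h' heq
  funext i
  refine scaleHom_injective (pow_mul_pow_sub p (hk i)) (pow_ne_zero _ (NeZero.ne p)) ?_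
  rw [← psi_apply hk, ← psi_apply hk, heq]

lemma bigPsi_injective (hk : ∀ i, k i ≤ k 0) : Function.Injective (bigPsi p k) :=
  (psi_injective hk).comp_left

lemma exists_psi_eq (hk : ∀ i, k i ≤ k 0) (hpos : ∀ i, 1 ≤ k i) {y : Fin n → ZMod (p ^ k 0)}
    (hy : p • y = 0) : ∃ h, psi p k h = y := by
  have pow_nsmul_eq_zero (i : Fin n) : p ^ k i • y i = 0 := by
    rw [← Nat.sub_add_cancel (hpos i), pow_succ, mul_nsmul', show p • y i = 0 from congrFun hy i,
      nsmul_zero]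
  choose h hh using fun i => exists_scaleHom_eq (pow_mul_pow_sub p (hk i)) (pow_nsmul_eq_zero i)
  exact ⟨h, funext fun i => by rw [psi_apply hk, hh]⟩

end Psi

section AssociatedLinear

variable {p n r : ℕ} [NeZero p] [NeZero n] {k : Fin n → ℕ}
  {f : (Fin (2 * r + 1) → PGroup p k) → PGroup p k}

lemma isAdditive_linearLocalRule {K : Type*} [CommRing K] {n : ℕ}
    (A : Fin (2 * r + 1) → Matrix (Fin n) (Fin n) K) : IsAdditive r (linearLocalRule r A) := by
  intro c c'
  funext i
  simp only [globalRule, linearLocalRule, Pi.add_apply, Matrix.mulVec_add, Finset.sum_add_distrib]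

lemma assocMatrix_mul_scaleHom (hk : ∀ i, k i ≤ k 0) (hf : IsAdditive r f) (z : Fin (2 * r + 1))
    (i j : Fin n) (x : ZMod (p ^ k j)) :
    assocMatrix p k r f z i j * scaleHom (pow_mul_pow_sub p (hk j)) x =
      scaleHom (pow_mul_pow_sub p (hk i)) (localPart hf z (Pi.single j x) i) :=
  entry_mul_scaleHom ((Pi.evalAddMonoidHom (fun i => ZMod (p ^ k i)) i).comp
    ((localPart hf z).comp (AddMonoidHom.single (fun i => ZMod (p ^ k i)) j)))
    (hk i) (hk j) x

lemma assocMatrix_mulVec_psi (hk : ∀ i, k i ≤ k 0) (hf : IsAdditive r f) (z : Fin (2 * r + 1))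
    (h : PGroup p k) :
    (assocMatrix p k r f z).mulVec (psi p k h) = psi p k (localPart hf z h) := by
  funext i
  conv_rhs => rw [← Finset.univ_sum_single h, psi_apply hk, map_sum, Finset.sum_apply, map_sum]
  simp only [Matrix.mulVec, dotProduct, psi_apply hk, assocMatrix_mul_scaleHom hk hf]

lemma linearLocalRule_psi (hk : ∀ i, k i ≤ k 0) (hf : IsAdditive r f)
    (w : Fin (2 * r + 1) → PGroup p k) :
    linearLocalRule r (assocMatrix p k r f) (fun t => psi p k (w t)) = psi p k (f w) := by
  simp only [linearLocalRule, assocMatrix_mulVec_psi hk hf]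
  rw [localRule_eq_sum hf, ← coe_psiHom hk, map_sum]

lemma assocLCA_comp_bigPsi (hk : ∀ i, k i ≤ k 0) (hf : IsAdditive r f) :
    assocLCA p k r f ∘ bigPsi p k = bigPsi p k ∘ globalRule r f :=
  funext fun _ => funext fun _ => linearLocalRule_psi hk hf _

end AssociatedLinear

section Transfer

lemma PositivelyExpansive.of_semiconj {S T : Type*} {F : (ℤ → S) → (ℤ → S)}
    {L : (ℤ → T) → (ℤ → T)} {ψ : S → T} (hL : PositivelyExpansive L)
    (hψ : Function.Injective ψ) (hFL : Function.Semiconj (ψ ∘ ·) F L) :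
    PositivelyExpansive F := by
  obtain ⟨m, h⟩ := positivelyExpansive_iff.1 hL
  refine positivelyExpansive_iff.2 ⟨m, fun c c' hc => hψ.comp_left (h _ _ fun l j hj => ?_)⟩
  rw [← (hFL.iterate_right l).eq, ← (hFL.iterate_right l).eq]
  exact congrArg ψ (hc l j hj)

lemma PositivelyExpansive.of_exists_nsmul_eq {G H : Type*} [AddCommGroup G] [AddCommGroup H]
    {Φ : (ℤ → G) →+ (ℤ → G)} {Λ : (ℤ → H) →+ (ℤ → H)} {ψ : G →+ H} (hΦ : PositivelyExpansive Φ)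
    (hψ : Function.Injective ψ) (hsemi : Function.Semiconj (ψ ∘ ·) Φ Λ)
    (exists_nsmul : ∀ b : ℤ → H, b ≠ 0 → ∃ (s : ℕ) (c : ℤ → G), ψ ∘ c = s • b ∧ s • b ≠ 0) :
    PositivelyExpansive Λ := by
  obtain ⟨m, h⟩ := (positivelyExpansive_addMonoidHom_iff Φ).1 hΦ
  refine (positivelyExpansive_addMonoidHom_iff Λ).2 ⟨m, fun b hb => by_contra fun hne => ?_⟩
  obtain ⟨s, c, hc, hsb⟩ := exists_nsmul b hne
  have c_eq_zero : c = 0 := h c fun l j hj => hψ <| by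
    have iterate_eq : ψ ∘ Φ^[l] c = s • Λ^[l] b := by
      rw [(hsemi.iterate_right l).eq, hc, iterate_map_nsmul]
    rw [map_zero, ← nsmul_zero s, ← hb l j hj]
    exact congrFun iterate_eq j
  exact hsb (by rw [← hc, c_eq_zero]; exact funext fun _ => map_zero ψ)

lemma exists_pow_nsmul {M : Type*} [AddMonoid M] {p m : ℕ} {b : M} (hb : p ^ m • b = 0)
    (hne : b ≠ 0) : ∃ t, p • p ^ t • b = 0 ∧ p ^ t • b ≠ 0 := by
  induction m with
  | zero => exact absurd (by rwa [pow_zero, one_nsmul] at hb) hne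
  | succ m ih =>
    by_cases hm : p ^ m • b = 0
    · exact ih hm
    · exact ⟨m, by rwa [← mul_nsmul', ← pow_succ'], hm⟩

theorem positivelyExpansive_assocLCA_iff {p n r : ℕ} [NeZero p] [NeZero n] {k : Fin n → ℕ}
    {f : (Fin (2 * r + 1) → PGroup p k) → PGroup p k} (hk : ∀ i, k i ≤ k 0)
    (hpos : ∀ i, 1 ≤ k i) (hf : IsAdditive r f) :
    PositivelyExpansive (globalRule r f) ↔ PositivelyExpansive (assocLCA p k r f) := by
  have hsemi : Function.Semiconj (bigPsi p k) (globalRule r f) (assocLCA p k r f) := fun c =>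
    (congrFun (assocLCA_comp_bigPsi hk hf) c).symm
  refine ⟨fun h => ?_, fun h => h.of_semiconj (psi_injective hk) hsemi⟩
  refine PositivelyExpansive.of_exists_nsmul_eq (Φ := caHom hf)
    (Λ := caHom (isAdditive_linearLocalRule (assocMatrix p k r f))) (ψ := psiHom hk) h
    (by rw [coe_psiHom]; exact psi_injective hk) (by rw [coe_psiHom]; exact hsemi) fun b hb => ?_
  have exponent : p ^ k 0 • b = 0 := by
    funext j i
    simp only [Pi.smul_apply, nsmul_eq_mul, ZMod.natCast_self, zero_mul, Pi.zero_apply]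
  obtain ⟨t, torsion, ne_zero⟩ := exists_pow_nsmul exponent hb
  choose c hc using fun j => exists_psi_eq hk hpos (congrFun torsion j)
  exact ⟨p ^ t, c, funext fun j => by rw [coe_psiHom]; exact hc j, ne_zero⟩

end Transfer

end AdditiveCA

theorem mainTheorem6_general :
    (∃ D : AdditiveCA.Code → Bool, Computable D ∧
      ∀ (G : Type*) [AddCommGroup G] (q : ℕ) (e : G ≃ Fin q) (r : ℕ)
        (f : (Fin (2 * r + 1) → G) → G), AdditiveCA.IsAdditive r f →
        (D (AdditiveCA.encodeCA e r f) = true ↔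
          AdditiveCA.PositivelyExpansive (AdditiveCA.globalRule r f))) ∧
    (∀ (p : ℕ) [NeZero p] (n : ℕ) [NeZero n] (k : Fin n → ℕ),
      (∀ i, 1 ≤ k i) → (∀ i, k i ≤ k 0) →
      ∀ (r : ℕ) (f : (Fin (2 * r + 1) → AdditiveCA.PGroup p k) → AdditiveCA.PGroup p k),
        AdditiveCA.IsAdditive r f →
        Function.Injective (AdditiveCA.bigPsi p k) ∧
        AdditiveCA.assocLCA p k r f ∘ AdditiveCA.bigPsi p k =
          AdditiveCA.bigPsi p k ∘ AdditiveCA.globalRule r f ∧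
        (AdditiveCA.PositivelyExpansive (AdditiveCA.globalRule r f) ↔
          AdditiveCA.PositivelyExpansive (AdditiveCA.assocLCA p k r f))) :=
  ⟨AdditiveCA.exists_computable_positivelyExpansive_decider, fun _ _ _ _ _ hpos hk _ _ hf =>
    ⟨AdditiveCA.bigPsi_injective hk, AdditiveCA.assocLCA_comp_bigPsi hk hf,
      AdditiveCA.positivelyExpansive_assocLCA_iff hk hpos hf⟩⟩

theorem mainTheorem6 :
    (∃ D : AdditiveCA.Code → Bool, Computable D ∧
      ∀ (G : Type*) [AddCommGroup G] (q : ℕ) (e : G ≃ Fin q) (r : ℕ)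
        (f : (Fin (2 * r + 1) → G) → G), AdditiveCA.IsAdditive r f →
        (D (AdditiveCA.encodeCA e r f) = true ↔
          AdditiveCA.PositivelyExpansive (AdditiveCA.globalRule r f))) ∧
    (∀ (p : ℕ), p.Prime → ∀ (n : ℕ) [NeZero n] (k : Fin n → ℕ),
      (∀ i, 1 ≤ k i) → Antitone k →
      ∀ (r : ℕ) (f : (Fin (2 * r + 1) → AdditiveCA.PGroup p k) → AdditiveCA.PGroup p k),
        AdditiveCA.IsAdditive r f →
        Function.Injective (AdditiveCA.bigPsi p k) ∧
        AdditiveCA.assocLCA p k r f ∘ AdditiveCA.bigPsi p k =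
          AdditiveCA.bigPsi p k ∘ AdditiveCA.globalRule r f ∧
        (AdditiveCA.PositivelyExpansive (AdditiveCA.globalRule r f) ↔
          AdditiveCA.PositivelyExpansive (AdditiveCA.assocLCA p k r f))) := by
  refine ⟨mainTheorem6_general.1, fun p hp n _ k hpos hanti => ?_⟩
  have : NeZero p := ⟨hp.ne_zero⟩
  exact mainTheorem6_general.{0}.2 p n k hpos fun i => hanti (Fin.zero_le i)
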